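/- Let $N\ge 0$, $m\ge1$, $\lambda,\mu\ge 0$, $\theta\in\mathbb R$, let $p_1,\dots,p_m\ge 0$ with $\sum_k p_k=1$, let $\Delta_1,\dots,\Delta_m>0$, and put $\Delta_{\max}=\max_k\Delta_k$. For a function $x=(x_1,\dots,x_N)$ on $[-\Delta_{\max},\infty)$ and $t\ge 0$ write $$M_i(x,t)=\frac{\exp\left(-\theta\sum_{k=1}^m p_k x_i(t-\Delta_k)\right)}{\sum_{j=1}^N\exp\left(-\theta\sum_{k=1}^m p_k x_j(t-\Delta_k)\right)} .$$ Let $\Pi^a_i,\Pi^d_i$ ($1\le i\le N$) be unit-rate Poisson processes on one probability space. For every integer $\eta\ge1$ let $Q^\eta=(Q^\eta_1,\dots,Q^\eta_N)$ be a jointly measurable $\mathbb R^N$-valued process on the time set $[-\Delta_{\max},\infty)$ which almost surely, for all $t\ge 0$ and all $i$, satisfies $Q^\eta_i(t)\ge 0$ and $$Q^\eta_i(t)=Q^\eta_i(0)+\frac1\eta\,\Pi^a_i\left(\eta\int_0^t\lambda M_i(Q^\eta,s)\,ds\right)-\frac1\eta\,\Pi^d_i\left(\eta\int_0^t\mu\,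 Q^\eta_i(s)\,ds\right).$$ Let $\varphi=(\varphi_1,\dots,\varphi_N):[-\Delta_{\max},0]\to\mathbb R^N$ be deterministic and assume that, for every $s\in[-\Delta_{\max},0]$ and every $i$, $Q^\eta_i(s)\to\varphi_i(s)$ almost surely as $\eta\to\infty$. Then there is exactly one function $q=(q_1,\dots,q_N)$ on $[-\Delta_{\max},\infty)$ that equals $\varphi$ on $[-\Delta_{\max},0]$, is continuous on $[0,\infty)$, and solves $$\dot q_i(t)=\lambda M_i(q,t)-\mu q_i(t),\qquad t\ge 0,\ 1\le i\le N,$$ in the integrated sense $q_i(t)=\varphi_i(0)+\int_0^t(\lambda M_i(q,s)-\mu q_i(s))\,ds$; if $\varphi$ is continuous, then the differential equation holds at every $t\ge 0$ (with the right derivative at $t=0$). Moreover, almost surely, $Q^\eta\to q$ as $\eta\to\infty$ uniformly on every compact subset of $[0,\infty)$. -/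

import Mathlib

open MeasureTheory ProbabilityTheory Filter Topology Set
open scoped NNReal

noncomputable section

namespace MultiDelayQueue

/-- A unit-rate Poisson process `(Y t)_{t ≥ 0}`: a counting process that starts at `0`, has
nondecreasing right-continuous paths, independent increments, and increments over `(s, t]` that are
Poisson with mean `t - s`. (Paths are nondecreasing, so the subtraction in `ℕ` is the true one.) -/
structure IsUnitPoissonProcess {Ω : Type*} [MeasurableSpace Ω] (Y : ℝ≥0 → Ω → ℕ)
    (P : Measure Ω) : Prop where
  zero : ∀ᵐ ω ∂P, Y 0 ω = 0
  mono : ∀ᵐ ω ∂P, Monotone fun t => Y t ω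
  rightCont : ∀ᵐ ω ∂P, ∀ t, ContinuousWithinAt (fun s => Y s ω) (Ici t) t
  indep : HasIndepIncrements Y P
  law : ∀ s t : ℝ≥0, s ≤ t → HasLaw (fun ω => Y t ω - Y s ω) (poissonMeasure (t - s)) P

/-- The multinomial-logit choice probability of queue `i` when the queue lengths (or the
information about them) are `x`. -/
def mnl {N : ℕ} (θ : ℝ) (x : Fin N → ℝ) (i : Fin N) : ℝ :=
  Real.exp (-θ * x i) / ∑ j, Real.exp (-θ * x j)

/-- The delayed information `(∑ k, p_k x_i(t - Δ_k))_i` that is in use at time `t`. -/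
def delayedInfo {N m : ℕ} (p Δ : Fin m → ℝ) (x : ℝ → Fin N → ℝ) (t : ℝ) (i : Fin N) : ℝ :=
  ∑ k, p k * x (t - Δ k) i

/-- The largest delay `max_k Δ_k`. -/
def maxDelay {m : ℕ} (Δ : Fin m → ℝ) : ℝ := ⨆ k, Δ k

/-- `Q` (a process on the time set `[-max_k Δ_k, ∞)`, its restriction to `[-max_k Δ_k, 0]` being the
initial history) is a queue length process with scaling parameter `η`, driven by the arrival
processes `Ya i` and the departure processes `Yd i`. Paths are measurable,
and almost surely, since the `Ya i` are nondecreasing, `nonneg` and `eqn` bound `Q` on every bounded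
subset of `[0, ∞)`; hence all integrals below are genuine, and they are nonnegative. -/
structure IsScaledQueue {Ω : Type*} [MeasurableSpace Ω] (P : Measure Ω) {N m : ℕ}
    (lam μ θ : ℝ) (p Δ : Fin m → ℝ) (Ya Yd : Fin N → ℝ≥0 → Ω → ℕ)
    (η : ℕ) (Q : ℝ → Ω → Fin N → ℝ) : Prop where
  measurable : Measurable fun x : Ici (-maxDelay Δ) × Ω => Q x.1 x.2
  nonneg : ∀ᵐ ω ∂P, ∀ t, 0 ≤ t → ∀ i, 0 ≤ Q t ω i
  eqn : ∀ᵐ ω ∂P, ∀ t, 0 ≤ t → ∀ i,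
    Q t ω i = Q 0 ω i
      + 1 / (η : ℝ) * (Ya i (Real.toNNReal (η * ∫ s in (0 : ℝ)..t,
          lam * mnl θ (delayedInfo p Δ (fun r => Q r ω) s) i)) ω : ℝ)
      - 1 / (η : ℝ) * (Yd i (Real.toNNReal (η * ∫ s in (0 : ℝ)..t, μ * Q s ω i)) ω : ℝ)

/-- The right-hand side `λ MNL_i - μ x_i(t)` of the delay differential system. -/
def fluidDrift {N m : ℕ} (lam μ θ : ℝ) (p Δ : Fin m → ℝ) (x : ℝ → Fin N → ℝ) (t : ℝ)
    (i : Fin N) : ℝ :=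
  lam * mnl θ (delayedInfo p Δ x t) i - μ * x t i

/-- `q` is a (Carathéodory) solution on `[-max_k Δ_k, ∞)` of the delay differential system
with history `φ`: it equals `φ` on `[-max_k Δ_k, 0]`, is continuous on `[0, ∞)`, and solves the
system in integrated form. -/
structure IsFluidSolution {N m : ℕ} (lam μ θ : ℝ) (p Δ : Fin m → ℝ) (φ : ℝ → Fin N → ℝ)
    (q : ℝ → Fin N → ℝ) : Prop where
  history : ∀ s ∈ Icc (-maxDelay Δ) 0, q s = φ s
  cont : ContinuousOn q (Ici 0)
  integrable : ∀ t, 0 ≤ t → ∀ i,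
    IntervalIntegrable (fun s => fluidDrift lam μ θ p Δ q s i) volume 0 t
  eqn : ∀ t, 0 ≤ t → ∀ i, q t i = φ 0 i + ∫ s in (0 : ℝ)..t, fluidDrift lam μ θ p Δ q s i

end MultiDelayQueue

end

/-!
The scaled queue is a small perturbation of the fluid equation: writing each Poisson process as its
mean plus a fluctuation,
`Q^η(t) = Q^η(0) + ∫₀ᵗ (λ M(Q^η, s) - μ Q^η(s)) ds + fluctuations`.
The fluctuations vanish uniformly on bounded time intervals by the functional law of large numbers
for Poisson processes (`IsUnitPoissonProcess.hasUnitRate`), because the arguments of the Poisson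
processes, divided by `η`, stay bounded: the arrival rate is at most `λ`, and the arrivals bound the
queue lengths and with them the departure rates (`IsScaledPath.le_of_unitRate`).

All delays are at least some `δ > 0`, so the choice probabilities at times up to `(n + 1) δ` depend
only on the history and on the path up to `n δ`. Hence both the equation and the convergence can be
treated in steps of length `δ`, and in each step the inflow is given and the equation is linear.
Existence of `q` is the stabilization of the iterates of the linear solution operator
(`exists_measurable_fixedPoint`); uniqueness (`IsFluidSolution.unique`) and uniform convergence in
each step (`tendstoUniformlyOn_of_joinProb`) follow from Gronwall's inequality, the latter with
dominated convergence for the inflow.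

The histories converge almost surely at each fixed time only. By Fubini's theorem, almost surely
they converge at almost every time (`ae_ae_tendsto`), which suffices for the integrated inflow; the
joint measurability of the histories also makes `φ` measurable on the history interval
(`measurable_of_forall_ae_tendsto`).
-/

noncomputable section

namespace MultiDelayQueue

/-! ### Gronwall's inequality in integral form -/

/-- Gronwall's inequality for an integrable function that need not be continuous, such as the
distance of a path with jumps to a continuous one. -/
theorem gronwall_integral {f : ℝ → ℝ} {C K T : ℝ} (hK : 0 ≤ K)
    (hf : IntegrableOn f (Icc 0 T))
    (h : ∀ t ∈ Icc (0 : ℝ) T, f t ≤ C + K * ∫ s in (0 : ℝ)..t, f s) :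
    ∀ t ∈ Icc (0 : ℝ) T, f t ≤ C * Real.exp (K * t) := by
  intro t ht
  have hT : 0 ≤ T := ht.1.trans ht.2
  set F : ℝ → ℝ := fun u => C + K * ∫ s in (0 : ℝ)..u, f s with hF
  have hFc : ContinuousOn F (Icc 0 T) := by
    have := intervalIntegral.continuousOn_primitive_interval (μ := volume) (f := f) (a := 0) (b := T)
      (by rwa [uIcc_of_le hT])
    rw [uIcc_of_le hT] at this
    exact continuousOn_const.add (continuousOn_const.mul this)
  -- `f` is only integrable, so the differential argument is run for its bound `F`, which is
  -- continuous and satisfies the same inequality; `F'` extends `F` by constants beyond `[0, T]`.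
  set F' : ℝ → ℝ := IccExtend hT (domRestrict (Icc 0 T) F) with hF'
  have hF'c : Continuous F' := (continuousOn_iff_continuous_domRestrict.1 hFc).Icc_extend'
  have hF'eq : ∀ u ∈ Icc (0 : ℝ) T, F' u = F u := fun u hu => by
    simp [hF', IccExtend_of_mem hT _ hu, domRestrict]
  set G : ℝ → ℝ := fun u => C + K * ∫ s in (0 : ℝ)..u, F' s with hG
  have hfF : ∀ u ∈ Icc (0 : ℝ) T, F u ≤ G u := by
    intro u hu
    have hsub : Icc 0 u ⊆ Icc 0 T := Icc_subset_Icc_right hu.2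
    have : ∫ s in (0 : ℝ)..u, f s ≤ ∫ s in (0 : ℝ)..u, F' s := by
      refine intervalIntegral.integral_mono_on hu.1 ?_ (hF'c.intervalIntegrable _ _) ?_
      · exact (intervalIntegrable_iff_integrableOn_Icc_of_le hu.1).2 (hf.mono_set hsub)
      · intro s hs
        rw [hF'eq s (hsub hs)]
        exact h s (hsub hs)
    simp only [hF, hG]
    gcongr
  have hGd : ∀ u, HasDerivAt G (K * F' u) u := fun u =>
    ((intervalIntegral.integral_hasDerivAt_right (hF'c.intervalIntegrable _ _)
      (hF'c.stronglyMeasurableAtFilter _ _) hF'c.continuousAt).const_mul K).const_add C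
  set H : ℝ → ℝ := fun u => Real.exp (-K * u) * G u with hH
  have hHd : ∀ u, HasDerivAt H (Real.exp (-K * u) * (K * (F' u - G u))) u := by
    intro u
    have h1 : HasDerivAt (fun u : ℝ => Real.exp (-K * u)) (Real.exp (-K * u) * (-K * 1)) u :=
      ((hasDerivAt_id u).const_mul (-K)).exp
    convert! h1.mul (hGd u) using 1
    ring
  have hanti : AntitoneOn H (Icc 0 T) := by
    refine antitoneOn_of_deriv_nonpos (convex_Icc _ _)
      (fun u _ => (hHd u).continuousAt.continuousWithinAt)
      (fun u _ => (hHd u).differentiableAt.differentiableWithinAt) ?_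
    intro u hu
    have hu' : u ∈ Icc 0 T := interior_subset hu
    rw [(hHd u).deriv, hF'eq u hu']
    have := hfF u hu'
    exact mul_nonpos_of_nonneg_of_nonpos (Real.exp_pos _).le
      (mul_nonpos_of_nonneg_of_nonpos hK (by linarith))
  have h0 : H t ≤ C := by
    have := hanti (left_mem_Icc.2 hT) ht ht.1
    simpa [hH, hG] using this
  calc f t ≤ F t := h t ht
    _ ≤ G t := hfF t ht
    _ = H t * Real.exp (K * t) := by
      simp only [hH]
      rw [mul_right_comm, ← Real.exp_add]; simp
    _ ≤ C * Real.exp (K * t) := by gcongr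

/-! ### The law of large numbers for unit-rate Poisson processes -/

theorem hasSum_poissonMeasure_one_id :
    HasSum (fun n : ℕ =>
      (Real.exp (-((1 : ℝ≥0) : ℝ)) * ((1 : ℝ≥0) : ℝ) ^ n / (n.factorial)) * (n : ℝ)) 1 := by
  have h1 := hasSum_one_poissonMeasure 1
  rw [← hasSum_nat_add_iff' 1]
  convert! h1 using 2 with n
  · rw [Nat.factorial_succ]
    push_cast
    field_simp
    simp
  · simp

theorem integrable_cast_poissonMeasure_one :
    Integrable (fun n : ℕ => (n : ℝ)) (poissonMeasure 1) := by
  rw [integrable_poissonMeasure_iff]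
  simpa using hasSum_poissonMeasure_one_id.summable

theorem integral_cast_poissonMeasure_one : ∫ n : ℕ, (n : ℝ) ∂(poissonMeasure 1) = 1 := by
  rw [integral_poissonMeasure]
  simpa using hasSum_poissonMeasure_one_id.tsum_eq

theorem IsUnitPoissonProcess.tendsto_nat_div {Ω : Type*} [MeasurableSpace Ω] {P : Measure Ω}
    {Y : ℝ≥0 → Ω → ℕ} (hY : IsUnitPoissonProcess Y P) :
    ∀ᵐ ω ∂P, Tendsto (fun n : ℕ => (Y n ω : ℝ) / n) atTop (𝓝 1) := by
  set X : ℕ → Ω → ℝ := fun k ω => ((Y ((k + 1 : ℕ) : ℝ≥0) ω - Y (k : ℝ≥0) ω : ℕ) : ℝ) with hX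
  have hlaw : ∀ k : ℕ, HasLaw (fun ω => Y ((k + 1 : ℕ) : ℝ≥0) ω - Y (k : ℝ≥0) ω)
      (poissonMeasure 1) P := by
    intro k
    have := hY.law k ((k + 1 : ℕ) : ℝ≥0) (by gcongr; omega)
    simpa using this
  have hmeas : Measurable (fun n : ℕ => (n : ℝ)) := measurable_from_top
  have hint : Integrable (X 0) P :=
    ((hlaw 0).map_eq ▸ integrable_cast_poissonMeasure_one).comp_aemeasurable (hlaw 0).aemeasurable
  have hmean : P[X 0] = 1 := by
    have := (hlaw 0).integral_comp hmeas.aestronglyMeasurable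
    rw [integral_cast_poissonMeasure_one] at this
    exact this
  have hindep : Pairwise (Function.onFun (fun f g => f ⟂ᵢ[P] g) X) := by
    intro i j hij
    have := (hY.indep.nat (t := fun n : ℕ => (n : ℝ≥0)) Nat.mono_cast).indepFun hij
    exact this.comp hmeas hmeas
  have hident : ∀ k, IdentDistrib (X k) (X 0) P P := fun k =>
    ((hlaw k).identDistrib (hlaw 0)).comp hmeas
  filter_upwards [strong_law_ae_real X hint hindep hident, hY.zero, hY.mono] with ω hω h0 hm
  rw [hmean] at hω
  convert hω using 3 with n
  have : ∀ k : ℕ, X k ω = (Y ((k + 1 : ℕ) : ℝ≥0) ω : ℝ) - Y (k : ℝ≥0) ω := by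
    intro k
    simp only [hX]
    rw [Nat.cast_sub]
    exact hm (by gcongr; omega)
  simp_rw [this]
  rw [Finset.sum_range_sub (fun k : ℕ => (Y (k : ℝ≥0) ω : ℝ))]
  simp [h0]

/-- Between integers, a monotone path is sandwiched by its values at the floor and the ceiling. -/
theorem tendsto_div_of_monotone {y : ℝ≥0 → ℕ} (hy : Monotone y)
    (h : Tendsto (fun n : ℕ => (y n : ℝ) / n) atTop (𝓝 1)) :
    Tendsto (fun t : ℝ => (y t.toNNReal : ℝ) / t) atTop (𝓝 1) := by
  have hfl : Tendsto (fun t : ℝ => ⌊t⌋₊) atTop atTop := tendsto_nat_floor_atTop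
  have hcl : Tendsto (fun t : ℝ => ⌈t⌉₊) atTop atTop := tendsto_nat_ceil_atTop
  have h1 := (h.comp hfl).mul (tendsto_nat_floor_div_atTop (R := ℝ))
  have h2 := (h.comp hcl).mul (tendsto_nat_ceil_div_atTop (R := ℝ))
  rw [mul_one] at h1 h2
  refine tendsto_of_tendsto_of_tendsto_of_le_of_le' h1 h2 ?_ ?_
  · filter_upwards [eventually_ge_atTop 1] with t ht
    have : (0 : ℝ) < ⌊t⌋₊ := by exact_mod_cast Nat.floor_pos.2 ht
    simp only [Function.comp]
    rw [div_mul_div_cancel₀ this.ne']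
    gcongr
    refine hy ?_
    rw [← NNReal.coe_le_coe, Real.coe_toNNReal _ (by linarith)]
    exact_mod_cast Nat.floor_le (by linarith)
  · filter_upwards [eventually_ge_atTop 1] with t ht
    have : (0 : ℝ) < ⌈t⌉₊ := by exact_mod_cast Nat.ceil_pos.2 (by linarith)
    simp only [Function.comp]
    rw [div_mul_div_cancel₀ this.ne']
    gcongr
    refine hy ?_
    rw [Real.toNNReal_le_iff_le_coe]
    exact_mod_cast Nat.le_ceil t

/-- The counting path `y` obeys the functional law of large numbers with rate one: `y (η u) / η`
converges to `u` as `η → ∞`, uniformly for `u` in bounded intervals. -/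
def HasUnitRate (y : ℝ≥0 → ℕ) : Prop :=
  ∀ T : ℝ, ∀ ε > 0, ∀ᶠ η : ℕ in atTop, ∀ u ∈ Icc (0 : ℝ) T,
    |1 / (η : ℝ) * (y (Real.toNNReal (η * u)) : ℝ) - u| ≤ ε

/-- Times beyond a fixed `R` have small relative error by the law of large numbers; the error before
`R` is bounded, and is killed by the factor `1 / η`. -/
theorem hasUnitRate_of_tendsto {y : ℝ≥0 → ℕ} (hy : Monotone y)
    (h : Tendsto (fun n : ℕ => (y n : ℝ) / n) atTop (𝓝 1)) : HasUnitRate y := by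
  intro T ε hε
  obtain hT | hT := lt_or_ge T 0
  · exact Eventually.of_forall fun η u hu => absurd (hu.1.trans hu.2) (not_le.2 hT)
  have h' := tendsto_div_of_monotone hy h
  set δ := ε / (2 * (T + 1)) with hδ
  have hδ0 : 0 < δ := by positivity
  obtain ⟨R, hR⟩ := eventually_atTop.1 ((Metric.tendsto_nhds.1 h' δ hδ0).and
    (eventually_gt_atTop 0))
  have hR0 : 0 < R := (hR R le_rfl).2
  set B : ℝ := y R.toNNReal + R with hB
  have hB0 : 0 < B := by positivity
  filter_upwards [eventually_ge_atTop (⌈2 * B / ε⌉₊ + 1)] with η hη u hu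
  have hη1 : (1 : ℝ) ≤ η := by exact_mod_cast (Nat.le_add_left 1 _).trans hη
  have hη0 : (0 : ℝ) < η := by linarith
  have hηB : 2 * B / ε ≤ η := (Nat.le_ceil _).trans (by exact_mod_cast (Nat.le_succ _).trans hη)
  have hBη : B / η ≤ ε / 2 := by
    rw [div_le_iff₀ hε] at hηB
    rw [div_le_iff₀ hη0]
    linarith
  have key : |(y (Real.toNNReal (η * u)) : ℝ) - η * u| ≤ δ * (η * u) + B := by
    have hηu : 0 ≤ η * u := mul_nonneg hη0.le hu.1
    obtain hle | hge := le_total (η * u) R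
    · have h1 : (y (Real.toNNReal (η * u)) : ℝ) ≤ y R.toNNReal := by
        exact_mod_cast hy (Real.toNNReal_le_toNNReal hle)
      have h2 : (0 : ℝ) ≤ y (Real.toNNReal (η * u)) := by positivity
      have h3 : 0 ≤ δ * (η * u) := by positivity
      rw [abs_le]
      constructor <;> simp only [hB] <;> nlinarith [Nat.cast_nonneg (α := ℝ) (y R.toNNReal)]
    · obtain ⟨h1, h2⟩ := hR _ hge
      rw [Real.dist_eq, div_sub_one h2.ne', abs_div, abs_of_pos h2, div_lt_iff₀ h2] at h1
      linarith
  have e : 1 / (η : ℝ) * (y (Real.toNNReal (η * u)) : ℝ) - u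
      = ((y (Real.toNNReal (η * u)) : ℝ) - η * u) / η := by field_simp
  rw [e, abs_div, abs_of_pos hη0]
  calc |(y (Real.toNNReal (η * u)) : ℝ) - η * u| / η ≤ (δ * (η * u) + B) / η := by gcongr
    _ = δ * u + B / η := by field_simp
    _ ≤ δ * (T + 1) + ε / 2 := by gcongr; linarith [hu.2]
    _ = ε := by rw [hδ]; field_simp; ring

theorem IsUnitPoissonProcess.hasUnitRate {Ω : Type*} [MeasurableSpace Ω] {P : Measure Ω}
    {Y : ℝ≥0 → Ω → ℕ} (hY : IsUnitPoissonProcess Y P) :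
    ∀ᵐ ω ∂P, HasUnitRate fun t => Y t ω := by
  filter_upwards [hY.mono, hY.tendsto_nat_div] with ω hm h
  exact hasUnitRate_of_tendsto hm h

/-! ### Choice probabilities and delays -/

theorem mnl_nonneg {N : ℕ} (θ : ℝ) (x : Fin N → ℝ) (i : Fin N) : 0 ≤ mnl θ x i := by
  unfold mnl; positivity

theorem mnl_le_one {N : ℕ} (θ : ℝ) (x : Fin N → ℝ) (i : Fin N) : mnl θ x i ≤ 1 := by
  unfold mnl
  refine div_le_one_of_le₀ ?_ (by positivity)
  exact Finset.single_le_sum (f := fun j => Real.exp (-θ * x j)) (fun j _ => by positivity)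
    (Finset.mem_univ i)

theorem continuous_mnl {N : ℕ} (θ : ℝ) (i : Fin N) : Continuous fun x => mnl θ x i := by
  unfold mnl
  refine Continuous.div (by fun_prop) (by fun_prop) fun x => ?_
  have : 0 < ∑ j, Real.exp (-θ * x j) :=
    Finset.sum_pos (fun j _ => Real.exp_pos _) ⟨i, Finset.mem_univ i⟩
  exact this.ne'

theorem le_maxDelay {m : ℕ} (Δ : Fin m → ℝ) (k : Fin m) : Δ k ≤ maxDelay Δ :=
  le_ciSup (f := Δ) (finite_range Δ).bddAbove k

theorem exists_pos_le_delay {m : ℕ} {Δ : Fin m → ℝ} (hΔ : ∀ k, 0 < Δ k) :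
    ∃ δ > 0, ∀ k, δ ≤ Δ k := by
  obtain hm | hm := isEmpty_or_nonempty (Fin m)
  · exact ⟨1, one_pos, fun k => (IsEmpty.false k).elim⟩
  · obtain ⟨k, hk⟩ := Finite.exists_min Δ
    exact ⟨Δ k, hΔ k, hk⟩

theorem maxDelay_nonneg {m : ℕ} {Δ : Fin m → ℝ} (hΔ : ∀ k, 0 < Δ k) : 0 ≤ maxDelay Δ :=
  Real.iSup_nonneg fun k => (hΔ k).le

/-- The probability with which a customer arriving at time `t` joins queue `i` when the queue
lengths have the path `x`. -/
def joinProb {N m : ℕ} (θ : ℝ) (p Δ : Fin m → ℝ) (x : ℝ → Fin N → ℝ) (t : ℝ) (i : Fin N) : ℝ :=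
  mnl θ (delayedInfo p Δ x t) i

section JoinProb

variable {N m : ℕ} {θ : ℝ} {p Δ : Fin m → ℝ} {x y : ℝ → Fin N → ℝ}

theorem joinProb_nonneg (t : ℝ) (i : Fin N) : 0 ≤ joinProb θ p Δ x t i := mnl_nonneg _ _ _

theorem joinProb_le_one (t : ℝ) (i : Fin N) : joinProb θ p Δ x t i ≤ 1 := mnl_le_one _ _ _

theorem joinProb_congr {t : ℝ} (h : ∀ k, x (t - Δ k) = y (t - Δ k)) :
    joinProb θ p Δ x t = joinProb θ p Δ y t := by
  have : delayedInfo p Δ x t = delayedInfo p Δ y t := by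
    funext i
    simp [delayedInfo, h]
  funext i
  simp [joinProb, this]

theorem tendsto_joinProb {X : ℕ → ℝ → Fin N → ℝ} {t : ℝ}
    (h : ∀ k, Tendsto (fun n => X n (t - Δ k)) atTop (𝓝 (x (t - Δ k)))) (i : Fin N) :
    Tendsto (fun n => joinProb θ p Δ (X n) t i) atTop (𝓝 (joinProb θ p Δ x t i)) := by
  refine ((continuous_mnl θ i).tendsto _).comp (tendsto_pi_nhds.2 fun j => ?_)
  exact tendsto_finsetSum _ fun k _ => ((tendsto_pi_nhds.1 (h k)) j).const_mul _

theorem measurable_joinProb (hx : Measurable x) (i : Fin N) :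
    Measurable fun t => joinProb θ p Δ x t i := by
  refine (continuous_mnl θ i).measurable.comp (measurable_pi_lambda _ fun j => ?_)
  refine Finset.measurable_sum _ fun k _ => Measurable.const_mul ?_ _
  exact (measurable_pi_apply j).comp (hx.comp (measurable_id.sub_const _))

theorem intervalIntegrable_joinProb (hx : Measurable x) (i : Fin N) (a b : ℝ) :
    IntervalIntegrable (fun t => joinProb θ p Δ x t i) volume a b := by
  refine (intervalIntegrable_const (c := (1 : ℝ))).mono_fun
    (measurable_joinProb hx i).aestronglyMeasurable (Eventually.of_forall fun t => ?_)
  simpa [abs_of_nonneg (joinProb_nonneg (θ := θ) (p := p) (Δ := Δ) (x := x) t i)] using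
    joinProb_le_one t i

/-- After time `0` only the values of the path on `[-max_k Δ_k, ∞)` matter. Freezing the path before
`-max_k Δ_k` turns measurability on that interval into measurability on the whole line. -/
theorem joinProb_eq_comp_max {t : ℝ} (ht : 0 ≤ t) :
    joinProb θ p Δ x t = joinProb θ p Δ (fun r => x (max r (-maxDelay Δ))) t := by
  refine joinProb_congr fun k => ?_
  rw [max_eq_left]
  linarith [le_maxDelay Δ k]

theorem intervalIntegrable_joinProb_of_comp_max
    (hx : Measurable fun r => x (max r (-maxDelay Δ))) (i : Fin N) {t : ℝ} (ht : 0 ≤ t) :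
    IntervalIntegrable (fun s => joinProb θ p Δ x s i) volume 0 t := by
  refine (intervalIntegrable_joinProb (θ := θ) (p := p) (Δ := Δ) hx i 0 t).congr fun s hs => ?_
  rw [uIoc_of_le ht] at hs
  exact congrFun (joinProb_eq_comp_max hs.1.le).symm i

end JoinProb

/-! ### Existence of the fluid limit -/

/-- The variation of constants formula for `y = A - μ ∫ y`, in a form which asks only for continuity
of `A`. -/
theorem linear_volterra {A : ℝ → ℝ} (hA : Continuous A) (μ : ℝ) :
    ∃ y : ℝ → ℝ,
      (∀ t, y t = A t - μ * (Real.exp (-μ * t) * ∫ s in (0 : ℝ)..t, Real.exp (μ * s) * A s)) ∧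
      Continuous y ∧ ∀ t, y t = A t - μ * ∫ s in (0 : ℝ)..t, y s := by
  set W : ℝ → ℝ := fun t => Real.exp (-μ * t) * ∫ s in (0 : ℝ)..t, Real.exp (μ * s) * A s with hW
  have hc : Continuous fun s => Real.exp (μ * s) * A s := by fun_prop
  have hWd : ∀ t, HasDerivAt W (A t - μ * W t) t := by
    intro t
    have h1 : HasDerivAt (fun u : ℝ => Real.exp (-μ * u)) (Real.exp (-μ * t) * (-μ * 1)) t :=
      ((hasDerivAt_id t).const_mul (-μ)).exp
    have h2 := intervalIntegral.integral_hasDerivAt_right (hc.intervalIntegrable 0 t)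
      (hc.stronglyMeasurableAtFilter _ _) hc.continuousAt
    convert! h1.mul h2 using 1
    have : Real.exp (-μ * t) * Real.exp (μ * t) = 1 := by rw [← Real.exp_add]; simp
    simp only [hW]
    linear_combination (-A t) * this
  have hWc : Continuous W := continuous_iff_continuousAt.2 fun t => (hWd t).continuousAt
  have hyc : Continuous fun t => A t - μ * W t := by fun_prop
  refine ⟨fun t => A t - μ * W t, fun t => rfl, hyc, fun t => ?_⟩
  have := intervalIntegral.integral_eq_sub_of_hasDerivAt (fun s _ => hWd s)
    (hyc.intervalIntegrable 0 t)
  simp only [this]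
  simp [hW]

section Existence

variable {N m : ℕ} (lam μ θ : ℝ) (p Δ : Fin m → ℝ) (ψ : ℝ → Fin N → ℝ)

/-- The initial value `ψ 0` plus the inflow up to time `t` that the path `x` generates. -/
def inflow (x : ℝ → Fin N → ℝ) (t : ℝ) (i : Fin N) : ℝ :=
  ψ 0 i + ∫ s in (0 : ℝ)..t, lam * joinProb θ p Δ x s i

/-- The map whose fixed points are the fluid solutions with history `ψ`: it solves the linear
equation in which the inflow is the one generated by `x`. The value at `t` depends on `x` only
through its values up to `t - min_k Δ_k`. -/
def fluidStep (x : ℝ → Fin N → ℝ) (t : ℝ) (i : Fin N) : ℝ :=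
  if t ≤ 0 then ψ t i else inflow lam θ p Δ ψ x t i - μ * (Real.exp (-μ * t) *
    ∫ s in (0 : ℝ)..t, Real.exp (μ * s) * inflow lam θ p Δ ψ x s i)

variable {lam μ θ p Δ ψ} {x y : ℝ → Fin N → ℝ}

theorem continuous_inflow (hx : Measurable x) (i : Fin N) :
    Continuous fun t => inflow lam θ p Δ ψ x t i :=
  continuous_const.add (intervalIntegral.continuous_primitive
    (fun a b => (intervalIntegrable_joinProb hx i a b).const_mul lam) 0)

/-- The variation of constants formula `fluidStep` solves the integrated equation from time `0` on. -/
theorem exists_fluidStep_eq (hx : Measurable x) (i : Fin N) :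
    ∃ z : ℝ → ℝ, Continuous z ∧ (∀ t, 0 ≤ t → fluidStep lam μ θ p Δ ψ x t i = z t) ∧
      ∀ t, z t = inflow lam θ p Δ ψ x t i - μ * ∫ s in (0 : ℝ)..t, z s := by
  obtain ⟨z, hz, hzc, hze⟩ := linear_volterra (continuous_inflow (lam := lam) (θ := θ) (p := p)
    (Δ := Δ) (ψ := ψ) hx i) μ
  refine ⟨z, hzc, fun t ht => ?_, hze⟩
  obtain rfl | ht := ht.eq_or_lt
  · simp [fluidStep, hz, inflow]
  · rw [fluidStep, if_neg (not_le.2 ht), hz]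

theorem measurable_fluidStep (hψ : Measurable ψ) (hx : Measurable x) :
    Measurable (fluidStep lam μ θ p Δ ψ x) := by
  refine measurable_pi_lambda _ fun i => ?_
  obtain ⟨z, hzc, hz, -⟩ := exists_fluidStep_eq (lam := lam) (μ := μ) (θ := θ) (p := p) (Δ := Δ)
    (ψ := ψ) hx i
  have : (fun t => fluidStep lam μ θ p Δ ψ x t i) = fun t => if t ≤ 0 then ψ t i else z t := by
    funext t
    split_ifs with h
    · simp [fluidStep, h]
    · exact hz t (not_le.1 h).le
  rw [this]
  exact Measurable.ite measurableSet_Iic ((measurable_pi_apply i).comp hψ) hzc.measurable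

/-- Agreement of two paths up to time `a` is improved by `fluidStep` to agreement up to `a + δ`, where
`δ` is below all delays. -/
theorem fluidStep_congr {δ a : ℝ} (hδ : ∀ k, δ ≤ Δ k) (h : ∀ t ≤ a, x t = y t) :
    ∀ t ≤ a + δ, fluidStep lam μ θ p Δ ψ x t = fluidStep lam μ θ p Δ ψ y t := by
  have hj : ∀ t ≤ a + δ, joinProb θ p Δ x t = joinProb θ p Δ y t := fun t ht =>
    joinProb_congr fun k => h _ (by linarith [hδ k])
  have hin : ∀ t, 0 ≤ t → t ≤ a + δ → inflow lam θ p Δ ψ x t = inflow lam θ p Δ ψ y t := by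
    intro t ht0 ht
    funext i
    unfold inflow
    congr 1
    refine intervalIntegral.integral_congr fun s hs => ?_
    rw [uIcc_of_le ht0] at hs
    simp only [hj s (hs.2.trans ht)]
  intro t ht
  funext i
  unfold fluidStep
  split_ifs with h0
  · rfl
  · have h0' : 0 ≤ t := (not_le.1 h0).le
    rw [hin t h0' ht]
    congr 3
    refine intervalIntegral.integral_congr fun s hs => ?_
    rw [uIcc_of_le h0'] at hs
    simp only [hin s hs.1 (hs.2.trans ht)]

/-- The method of steps: by `fluidStep_congr` the iterates from the history become stationary on every
half-line `(-∞, n δ]`, and their limit is a fixed point. -/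
theorem exists_measurable_fixedPoint (hΔ : ∀ k, 0 < Δ k) (hψ : Measurable ψ) :
    ∃ q, Measurable q ∧ fluidStep lam μ θ p Δ ψ q = q := by
  obtain ⟨δ, hδ0, hδ⟩ := exists_pos_le_delay hΔ
  have hcongr : ∀ (x y : ℝ → Fin N → ℝ) (a : ℝ), (∀ t ≤ a, x t = y t) → ∀ t ≤ a + δ,
      fluidStep lam μ θ p Δ ψ x t = fluidStep lam μ θ p Δ ψ y t :=
    fun x y a h => fluidStep_congr hδ h
  have hpast : ∀ t ≤ 0, fluidStep lam μ θ p Δ ψ ψ t = ψ t := fun t ht => by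
    funext i
    simp [fluidStep, ht]
  have hTm : ∀ x, Measurable x → Measurable (fluidStep lam μ θ p Δ ψ x) :=
    fun x hx => measurable_fluidStep hψ hx
  generalize fluidStep lam μ θ p Δ ψ = T at hcongr hpast hTm ⊢
  have hmeas : ∀ n, Measurable (T^[n] ψ) := by
    intro n
    induction n with
    | zero => exact hψ
    | succ n ih =>
      rw [Function.iterate_succ_apply']
      exact hTm _ ih
  have hstep : ∀ n : ℕ, ∀ t ≤ n * δ, T^[n + 1] ψ t = T^[n] ψ t := by
    intro n
    induction n with
    | zero =>
      intro t ht
      exact hpast t (by simpa using ht)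
    | succ n ih =>
      intro t ht
      have := hcongr _ _ _ ih t (by push_cast at ht; linarith)
      rwa [← Function.iterate_succ_apply' T, ← Function.iterate_succ_apply' T] at this
  have hstab : ∀ n k : ℕ, ∀ t ≤ n * δ, T^[n + k] ψ t = T^[n] ψ t := by
    intro n k
    induction k with
    | zero => simp
    | succ k ih =>
      intro t ht
      rw [← ih t ht, ← add_assoc]
      refine hstep _ _ (ht.trans ?_)
      gcongr
      omega
  have hceil : ∀ t : ℝ, t ≤ ⌈t / δ⌉₊ * δ := fun t => by
    have := Nat.le_ceil (t / δ)
    rwa [div_le_iff₀ hδ0] at this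
  set q : ℝ → Fin N → ℝ := fun t => T^[⌈t / δ⌉₊] ψ t with hq
  have hqn : ∀ n : ℕ, ∀ t ≤ n * δ, q t = T^[n] ψ t := by
    intro n t ht
    have : ⌈t / δ⌉₊ ≤ n := Nat.ceil_le.2 (by rwa [div_le_iff₀ hδ0])
    obtain ⟨k, rfl⟩ := Nat.exists_eq_add_of_le this
    exact (hstab _ k t (hceil t)).symm
  refine ⟨q, ?_, ?_⟩
  · refine measurable_of_tendsto_metrizable hmeas (tendsto_pi_nhds.2 fun t => ?_)
    refine tendsto_const_nhds.congr' ?_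
    filter_upwards [eventually_ge_atTop ⌈t / δ⌉₊] with n hn
    refine hqn n t ((hceil t).trans ?_)
    gcongr
  · funext t
    have h1 := hcongr _ _ _ (hqn ⌈t / δ⌉₊) t ((hceil t).trans (by linarith))
    rw [h1, ← Function.iterate_succ_apply' T, hstep _ t (hceil t)]

theorem isFluidSolution_of_fixedPoint (hD : 0 ≤ maxDelay Δ) {φ q : ℝ → Fin N → ℝ}
    (hψφ : ∀ s ∈ Icc (-maxDelay Δ) 0, ψ s = φ s) (hq : Measurable q)
    (hfix : fluidStep lam μ θ p Δ ψ q = q) :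
    IsFluidSolution lam μ θ p Δ φ q := by
  have h := fun i => exists_fluidStep_eq (lam := lam) (μ := μ) (θ := θ) (p := p) (Δ := Δ)
    (ψ := ψ) hq i
  rw [hfix] at h
  choose z hzc hzq hze using h
  have hdrift : ∀ t, 0 ≤ t → ∀ i, IntervalIntegrable (fun s => q s i) volume 0 t ∧
      ∫ s in (0 : ℝ)..t, q s i = ∫ s in (0 : ℝ)..t, z i s := by
    intro t ht i
    have he : ∀ s ∈ uIcc 0 t, z i s = q s i := fun s hs => by
      rw [uIcc_of_le ht] at hs
      exact (hzq i s hs.1).symm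
    exact ⟨((hzc i).intervalIntegrable 0 t).congr fun s hs => he s (uIoc_subset_uIcc hs),
      (intervalIntegral.integral_congr he).symm⟩
  refine ⟨?_, ?_, ?_, ?_⟩
  · intro s hs
    rw [← hψφ s hs, ← hfix]
    funext i
    simp [fluidStep, hs.2]
  · exact continuousOn_pi.2 fun i => (hzc i).continuousOn.congr fun t ht => hzq i t ht
  · intro t ht i
    exact ((intervalIntegrable_joinProb hq i 0 t).const_mul lam).sub
      ((hdrift t ht i).1.const_mul μ)
  · intro t ht i
    have h2 : ∫ s in (0 : ℝ)..t, fluidDrift lam μ θ p Δ q s i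
        = (∫ s in (0 : ℝ)..t, lam * joinProb θ p Δ q s i) - ∫ s in (0 : ℝ)..t, μ * q s i :=
      intervalIntegral.integral_sub ((intervalIntegrable_joinProb hq i 0 t).const_mul lam)
        ((hdrift t ht i).1.const_mul μ)
    rw [h2, intervalIntegral.integral_const_mul μ, (hdrift t ht i).2, hzq i t ht, hze, inflow,
      hψφ 0 ⟨by linarith, le_rfl⟩]
    ring

end Existence

/-! ### Uniqueness and regularity of the fluid limit -/

section Solution

variable {N m : ℕ} {lam μ θ : ℝ} {p Δ : Fin m → ℝ} {φ q : ℝ → Fin N → ℝ}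

theorem IsFluidSolution.intervalIntegrable (h : IsFluidSolution lam μ θ p Δ φ q) {t : ℝ}
    (ht : 0 ≤ t) (i : Fin N) : IntervalIntegrable (fun s => q s i) volume 0 t := by
  refine ContinuousOn.intervalIntegrable ((continuousOn_pi.1 h.cont i).mono ?_)
  rw [uIcc_of_le ht]
  exact Icc_subset_Ici_self

/-- Two solutions that agree up to `n δ` have the same inflow up to `(n + 1) δ`, so that only the linear
outflow is left, which Gronwall's inequality controls. -/
theorem IsFluidSolution.unique {q' : ℝ → Fin N → ℝ} (hμ : 0 ≤ μ) (hΔ : ∀ k, 0 < Δ k)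
    (h : IsFluidSolution lam μ θ p Δ φ q) (h' : IsFluidSolution lam μ θ p Δ φ q') :
    ∀ t, -maxDelay Δ ≤ t → q' t = q t := by
  obtain ⟨δ, hδ0, hδ⟩ := exists_pos_le_delay hΔ
  have key : ∀ n : ℕ, ∀ t, -maxDelay Δ ≤ t → t ≤ n * δ → q' t = q t := by
    intro n
    induction n with
    | zero =>
      intro t ht ht0
      have ht0 : t ≤ 0 := by simpa using ht0
      rw [h.history t ⟨ht, ht0⟩, h'.history t ⟨ht, ht0⟩]
    | succ n ih =>
      intro t ht htn
      obtain ht0 | ht0 := le_total t 0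
      · rw [h.history t ⟨ht, ht0⟩, h'.history t ⟨ht, ht0⟩]
      funext i
      have hint : IntegrableOn (fun s => |q' s i - q s i|) (Icc 0 t) :=
        (intervalIntegrable_iff_integrableOn_Icc_of_le ht0).1
          ((h'.intervalIntegrable ht0 i).sub (h.intervalIntegrable ht0 i)).abs
      have hle := gronwall_integral (C := 0) hμ hint (fun u hu => by
        have e : q' u i - q u i = ∫ s in (0 : ℝ)..u, -μ * (q' s i - q s i) := by
          rw [h.eqn u hu.1 i, h'.eqn u hu.1 i, add_sub_add_left_eq_sub,
            ← intervalIntegral.integral_sub (h'.integrable u hu.1 i) (h.integrable u hu.1 i)]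
          refine intervalIntegral.integral_congr fun s hs => ?_
          rw [uIcc_of_le hu.1] at hs
          have hj : joinProb θ p Δ q' s = joinProb θ p Δ q s := joinProb_congr fun k =>
            ih _ (by linarith [le_maxDelay Δ k, hs.1])
              (by push_cast at htn; linarith [hδ k, hs.2, hu.2])
          have hj' := congrFun hj i
          simp only [joinProb] at hj'
          simp only [fluidDrift, hj']
          ring
        rw [e, intervalIntegral.integral_const_mul, abs_mul, abs_neg, abs_of_nonneg hμ, zero_add]
        gcongr
        exact intervalIntegral.abs_integral_le_integral_abs hu.1) t ⟨ht0, le_rfl⟩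
      rw [zero_mul] at hle
      exact sub_eq_zero.1 (abs_nonpos_iff.1 hle)
  intro t ht
  refine key ⌈t / δ⌉₊ t ht ?_
  have := Nat.le_ceil (t / δ)
  rwa [div_le_iff₀ hδ0] at this

theorem IsFluidSolution.continuousOn (hD : 0 ≤ maxDelay Δ) (h : IsFluidSolution lam μ θ p Δ φ q)
    (hφ : ContinuousOn φ (Icc (-maxDelay Δ) 0)) : ContinuousOn q (Ici (-maxDelay Δ)) := by
  have h1 : ContinuousOn q (Icc (-maxDelay Δ) 0) := hφ.congr h.history
  have := h1.union_of_isClosed h.cont isClosed_Icc isClosed_Ici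
  rwa [Icc_union_Ici_eq_Ici (by linarith)] at this

theorem IsFluidSolution.hasDerivWithinAt (hD : 0 ≤ maxDelay Δ)
    (h : IsFluidSolution lam μ θ p Δ φ q)
    (hφ : ContinuousOn φ (Icc (-maxDelay Δ) 0)) {t : ℝ} (ht : 0 ≤ t) (i : Fin N) :
    HasDerivWithinAt (fun s => q s i) (fluidDrift lam μ θ p Δ q t i) (Ici 0) t := by
  have hq := h.continuousOn hD hφ
  -- the drift, frozen before time `0`, is continuous on the whole line
  set g : ℝ → ℝ := fun s => fluidDrift lam μ θ p Δ q (max s 0) i with hg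
  have hc : ∀ d ≤ maxDelay Δ, Continuous fun s : ℝ => q (max s 0 - d) := fun d hd =>
    hq.comp_continuous (by fun_prop) fun s => by
      have := le_max_right s 0
      simp only [mem_Ici]; linarith
  have hgc : Continuous g := by
    refine Continuous.sub (continuous_const.mul ((continuous_mnl θ i).comp
      (continuous_pi fun j => ?_))) (continuous_const.mul ?_)
    · exact continuous_finsetSum _ fun k _ => continuous_const.mul
        ((continuous_apply j).comp (hc (Δ k) (le_maxDelay Δ k)))
    · have := (continuous_apply i).comp (hc 0 hD)
      simpa [Function.comp_def] using this
  have hgt : ∀ s, 0 ≤ s → g s = fluidDrift lam μ θ p Δ q s i := fun s hs => by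
    simp [hg, max_eq_left hs]
  have heq : ∀ u ∈ Ici (0 : ℝ), q u i = φ 0 i + ∫ s in (0 : ℝ)..u, g s := by
    intro u hu
    rw [h.eqn u hu i]
    congr 1
    refine intervalIntegral.integral_congr fun s hs => ?_
    rw [uIcc_of_le hu] at hs
    exact (hgt s hs.1).symm
  rw [← hgt t ht]
  exact (((intervalIntegral.integral_hasDerivAt_right (hgc.intervalIntegrable 0 t)
    (hgc.stronglyMeasurableAtFilter _ _) hgc.continuousAt).const_add (φ 0 i)).hasDerivWithinAt).congr
    heq (heq t ht)

end Solution

/-! ### Limits of jointly measurable processes -/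

/-- A deterministic pointwise almost sure limit of jointly measurable processes is measurable. The
proof applies the bounded injective function `arctan` to make the expectations converge. -/
theorem measurable_of_forall_ae_tendsto {S Ω : Type*} [MeasurableSpace S] [MeasurableSpace Ω]
    {P : Measure Ω} [IsProbabilityMeasure P] {f : ℕ → S × Ω → ℝ} (hf : ∀ n, Measurable (f n))
    {g : S → ℝ} (h : ∀ s, ∀ᵐ ω ∂P, Tendsto (fun n => f n (s, ω)) atTop (𝓝 (g s))) :
    Measurable g := by
  have hlim : Measurable fun s => Real.arctan (g s) := by
    refine measurable_of_tendsto_metrizable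
      (f := fun n s => ∫ ω, Real.arctan (f n (s, ω)) ∂P) (fun n => ?_)
      (tendsto_pi_nhds.2 fun s => ?_)
    · exact (StronglyMeasurable.integral_prod_right (f := fun s ω => Real.arctan (f n (s, ω)))
        (Real.continuous_arctan.measurable.comp (hf n)).stronglyMeasurable).measurable
    · have := tendsto_integral_of_dominated_convergence (μ := P)
        (F := fun n ω => Real.arctan (f n (s, ω))) (f := fun _ => Real.arctan (g s))
        (fun _ => Real.pi / 2)
        (fun n => (Real.continuous_arctan.measurable.comp
          ((hf n).comp measurable_prodMk_left)).aestronglyMeasurable)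
        (integrable_const _)
        (fun n => Eventually.of_forall fun ω => (Real.norm_eq_abs _).trans_le
          (abs_le.2 ⟨(Real.neg_pi_div_two_lt_arctan _).le, (Real.arctan_lt_pi_div_two _).le⟩))
        ((h s).mono fun ω hω => (Real.continuous_arctan.tendsto _).comp hω)
      simpa using this
  have : g = fun s => Real.sin (Real.arctan (g s)) / Real.cos (Real.arctan (g s)) := by
    funext s
    rw [← Real.tan_eq_sin_div_cos, Real.tan_arctan]
  rw [this]
  exact (Real.measurable_sin.comp hlim).div (Real.measurable_cos.comp hlim)

/-- Almost sure convergence at every fixed time gives, for almost every sample point, convergence at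
almost every time. -/
theorem ae_ae_tendsto {S Ω : Type*} [MeasurableSpace S] [MeasurableSpace Ω] {ν : Measure S}
    [SFinite ν]
    {P : Measure Ω} [IsProbabilityMeasure P] {f : ℕ → S × Ω → ℝ} (hf : ∀ n, Measurable (f n))
    {g : S → ℝ} (hg : Measurable g)
    (h : ∀ s, ∀ᵐ ω ∂P, Tendsto (fun n => f n (s, ω)) atTop (𝓝 (g s))) :
    ∀ᵐ ω ∂P, ∀ᵐ s ∂ν, Tendsto (fun n => f n (s, ω)) atTop (𝓝 (g s)) := by
  have hset : MeasurableSet {z : S × Ω | Tendsto (fun n => f n z) atTop (𝓝 (g z.1))} :=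
    measurableSet_tendsto_fun hf (hg.comp measurable_fst)
  exact (Measure.ae_ae_comm hset).1 (Eventually.of_forall h)

/-! ### Convergence of the scaled paths -/

section Path

variable {N m : ℕ} {lam μ θ : ℝ} {p Δ : Fin m → ℝ}

/-- A single sample path `x` of a queue length process with scaling parameter `η`, driven by the
counting paths `ya i` and `yd i`. Measurability is required on `[-max_k Δ_k, ∞)` only, expressed by
freezing the path before that interval. -/
structure IsScaledPath (lam μ θ : ℝ) (p Δ : Fin m → ℝ) (ya yd : Fin N → ℝ≥0 → ℕ) (η : ℕ)
    (x : ℝ → Fin N → ℝ) : Prop where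
  measurable : Measurable fun r => x (max r (-maxDelay Δ))
  nonneg : ∀ t, 0 ≤ t → ∀ i, 0 ≤ x t i
  eqn : ∀ t, 0 ≤ t → ∀ i, x t i = x 0 i
      + 1 / (η : ℝ) * (ya i (Real.toNNReal (η * ∫ s in (0 : ℝ)..t, lam * joinProb θ p Δ x s i)) : ℝ)
      - 1 / (η : ℝ) * (yd i (Real.toNNReal (η * ∫ s in (0 : ℝ)..t, μ * x s i)) : ℝ)

variable {ya yd : Fin N → ℝ≥0 → ℕ} {x : ℝ → Fin N → ℝ} {η : ℕ}

theorem IsScaledPath.integral_joinProb_mem (h : IsScaledPath lam μ θ p Δ ya yd η x)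
    (hlam : 0 ≤ lam) {T t : ℝ} (ht : t ∈ Icc 0 T) (i : Fin N) :
    (∫ s in (0 : ℝ)..t, lam * joinProb θ p Δ x s i) ∈ Icc 0 (lam * T) := by
  constructor
  · exact intervalIntegral.integral_nonneg ht.1 fun s _ => mul_nonneg hlam (joinProb_nonneg s i)
  · calc (∫ s in (0 : ℝ)..t, lam * joinProb θ p Δ x s i)
        ≤ ∫ s in (0 : ℝ)..t, lam := by
          refine intervalIntegral.integral_mono_on ht.1
            ((intervalIntegrable_joinProb_of_comp_max h.measurable i ht.1).const_mul lam)
            intervalIntegrable_const fun s _ => ?_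
          exact mul_le_of_le_one_right hlam (joinProb_le_one s i)
      _ = lam * t := by simp [mul_comm]
      _ ≤ lam * T := by gcongr; exact ht.2

/-- The departures only lower the queue, so the arrivals alone bound it. -/
theorem IsScaledPath.le_of_unitRate (h : IsScaledPath lam μ θ p Δ ya yd η x) (hlam : 0 ≤ lam)
    {T : ℝ} {i : Fin N}
    (hrate : ∀ u ∈ Icc (0 : ℝ) (lam * T),
      |1 / (η : ℝ) * (ya i (Real.toNNReal (η * u)) : ℝ) - u| ≤ 1) :
    ∀ t ∈ Icc 0 T, x t i ≤ x 0 i + lam * T + 1 := by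
  intro t ht
  have h1 := h.integral_joinProb_mem hlam ht i
  have h2 := (abs_le.1 (hrate _ h1)).2
  have h3 : 0 ≤ 1 / (η : ℝ) * (yd i (Real.toNNReal (η * ∫ s in (0 : ℝ)..t, μ * x s i)) : ℝ) := by
    positivity
  rw [h.eqn t ht.1 i]
  linarith [h1.2]

theorem IsScaledPath.integrableOn (h : IsScaledPath lam μ θ p Δ ya yd η x) (hD : 0 ≤ maxDelay Δ)
    {T B : ℝ} {i : Fin N} (hB : ∀ t ∈ Icc 0 T, x t i ≤ B) :
    IntegrableOn (fun t => x t i) (Icc 0 T) := by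
  have heq : EqOn (fun r => x (max r (-maxDelay Δ)) i) (fun t => x t i) (Icc 0 T) := fun t ht => by
    simp only
    rw [max_eq_left (by linarith [ht.1])]
  refine IntegrableOn.congr_fun ?_ heq measurableSet_Icc
  refine Measure.integrableOn_of_bounded (M := B) (by simp)
    ((measurable_pi_apply i).comp h.measurable).aestronglyMeasurable ?_
  refine (ae_restrict_iff' measurableSet_Icc).2 (Eventually.of_forall fun t ht => ?_)
  have := heq ht
  simp only at this
  rw [this, Real.norm_eq_abs, abs_of_nonneg (h.nonneg t ht.1 i)]
  exact hB t ht

variable {φ q : ℝ → Fin N → ℝ} {X : ℕ → ℝ → Fin N → ℝ}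

theorem tendsto_integral_abs_joinProb_sub
    (hX : ∀ᶠ n in atTop, Measurable fun r => X n (max r (-maxDelay Δ)))
    (hq : Measurable fun r => q (max r (-maxDelay Δ))) {T : ℝ} (hT : 0 ≤ T) (i : Fin N)
    (hlim : ∀ᵐ s, s ∈ Icc 0 T →
      Tendsto (fun n => joinProb θ p Δ (X n) s i) atTop (𝓝 (joinProb θ p Δ q s i))) :
    Tendsto (fun n => ∫ s in (0 : ℝ)..T, |joinProb θ p Δ (X n) s i - joinProb θ p Δ q s i|)
      atTop (𝓝 0) := by
  have := intervalIntegral.tendsto_integral_filter_of_dominated_convergence (μ := volume)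
    (a := 0) (b := T) (l := atTop)
    (F := fun n s => |joinProb θ p Δ (X n) s i - joinProb θ p Δ q s i|) (f := fun _ => (0 : ℝ))
    (fun _ => 1) ?_ ?_ intervalIntegrable_const ?_
  · simpa using this
  · filter_upwards [hX] with n hn
    exact (((intervalIntegrable_joinProb_of_comp_max hn i hT).sub
      (intervalIntegrable_joinProb_of_comp_max hq i hT)).abs).def'.aestronglyMeasurable
  · refine Eventually.of_forall fun n => Eventually.of_forall fun s _ => ?_
    rw [Real.norm_eq_abs, abs_abs, abs_le]
    have h1 := joinProb_nonneg (θ := θ) (p := p) (Δ := Δ) (x := X n) s i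
    have h2 := joinProb_le_one (θ := θ) (p := p) (Δ := Δ) (x := X n) s i
    have h3 := joinProb_nonneg (θ := θ) (p := p) (Δ := Δ) (x := q) s i
    have h4 := joinProb_le_one (θ := θ) (p := p) (Δ := Δ) (x := q) s i
    constructor <;> linarith
  · filter_upwards [hlim] with s hs hsT
    rw [uIoc_of_le hT] at hsT
    have := ((hs ⟨hsT.1.le, hsT.2⟩).sub_const (joinProb θ p Δ q s i)).abs
    simpa using this

/-- If the choice probabilities converge at almost every time in `[0, T]`, then the paths converge
uniformly on `[0, T]`. The difference `X n - q` is a sum of the initial error, the two Poisson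
fluctuations, the error of the inflow and the integral of `-μ (X n - q)`; the first four are at most
`κ` for large `n`, and Gronwall's inequality absorbs the last. -/
theorem tendstoUniformlyOn_of_joinProb (hlam : 0 ≤ lam) (hμ : 0 ≤ μ) (hD : 0 ≤ maxDelay Δ)
    (hsol : IsFluidSolution lam μ θ p Δ φ q) (hq : Measurable fun r => q (max r (-maxDelay Δ)))
    (hya : ∀ i, HasUnitRate (ya i)) (hyd : ∀ i, HasUnitRate (yd i))
    (hX : ∀ᶠ n in atTop, IsScaledPath lam μ θ p Δ ya yd n (X n))
    (h0 : ∀ i, Tendsto (fun n => X n 0 i) atTop (𝓝 (φ 0 i))) {T : ℝ} (hT : 0 ≤ T)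
    (hlim : ∀ᵐ s, s ∈ Icc 0 T → ∀ i,
      Tendsto (fun n => joinProb θ p Δ (X n) s i) atTop (𝓝 (joinProb θ p Δ q s i))) :
    TendstoUniformlyOn X q atTop (Icc 0 T) := by
  rw [Metric.tendstoUniformlyOn_iff]
  intro ε hε
  set C : ℝ := Real.exp (μ * T) with hC
  have hC0 : 0 < C := Real.exp_pos _
  set κ : ℝ := ε / (8 * C) with hκ
  have hκ0 : 0 < κ := by positivity
  suffices h : ∀ i, ∀ᶠ n in atTop, ∀ t ∈ Icc 0 T, |X n t i - q t i| < ε by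
    filter_upwards [eventually_all.2 h] with n hn t ht
    rw [dist_pi_lt_iff hε]
    intro i
    rw [dist_comm, Real.dist_eq]
    exact hn i t ht
  intro i
  have hint := (tendsto_integral_abs_joinProb_sub (hX.mono fun n hn => hn.measurable) hq hT i
    (hlim.mono fun s hs hsT => hs hsT i)).const_mul lam
  rw [mul_zero] at hint
  -- a bound for the queue lengths on `[0, T]`, uniform in the scaling
  set B : ℝ := φ 0 i + 1 + lam * T + 1 with hB
  filter_upwards [hX, (Metric.tendsto_nhds.1 (h0 i)) 1 one_pos, (Metric.tendsto_nhds.1 (h0 i)) κ hκ0,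
    hya i (lam * T) 1 one_pos, hya i (lam * T) κ hκ0, hyd i (μ * B * T) κ hκ0,
    (Metric.tendsto_nhds.1 hint) κ hκ0] with n hn h01 h0κ ha1 haκ hdκ hjκ
  rw [Real.dist_eq] at h01 h0κ hjκ
  rw [sub_zero] at hjκ
  have hXB : ∀ t ∈ Icc 0 T, X n t i ≤ B := fun t ht =>
    (hn.le_of_unitRate hlam ha1 t ht).trans (by rw [hB]; linarith [(abs_lt.1 h01).2])
  have hXint := hn.integrableOn hD hXB
  have hXI : ∀ t ∈ Icc 0 T, IntervalIntegrable (fun s => X n s i) volume 0 t := fun t ht =>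
    (intervalIntegrable_iff_integrableOn_Icc_of_le ht.1).2
      (hXint.mono_set (Icc_subset_Icc_right ht.2))
  have hqI : ∀ t ∈ Icc 0 T, IntervalIntegrable (fun s => q s i) volume 0 t := fun t ht =>
    hsol.intervalIntegrable ht.1 i
  have hbound : ∀ t ∈ Icc 0 T, |X n t i - q t i| ≤
      4 * κ + μ * ∫ s in (0 : ℝ)..t, |X n s i - q s i| := by
    intro t ht
    have hJX := intervalIntegrable_joinProb_of_comp_max (θ := θ) (p := p) hn.measurable i ht.1
    have hJq := intervalIntegrable_joinProb_of_comp_max (θ := θ) (p := p) hq i ht.1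
    set a := ∫ s in (0 : ℝ)..t, lam * joinProb θ p Δ (X n) s i with ha
    set d := ∫ s in (0 : ℝ)..t, μ * X n s i with hd
    have haM : a ∈ Icc 0 (lam * T) := hn.integral_joinProb_mem hlam ht i
    have hB0 : 0 ≤ B := (hn.nonneg t ht.1 i).trans (hXB t ht)
    have hdM : d ∈ Icc 0 (μ * B * T) := by
      constructor
      · exact intervalIntegral.integral_nonneg ht.1 fun s hs => mul_nonneg hμ (hn.nonneg s hs.1 i)
      · calc d ≤ ∫ s in (0 : ℝ)..t, μ * B :=
              intervalIntegral.integral_mono_on ht.1 ((hXI t ht).const_mul μ)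
                intervalIntegrable_const fun s hs =>
                  mul_le_mul_of_nonneg_left (hXB s ⟨hs.1, hs.2.trans ht.2⟩) hμ
          _ = μ * B * t := by rw [intervalIntegral.integral_const, sub_zero, smul_eq_mul, mul_comm]
          _ ≤ μ * B * T := by gcongr; exact ht.2
    have e1 : a - ∫ s in (0 : ℝ)..t, lam * joinProb θ p Δ q s i
        = lam * ∫ s in (0 : ℝ)..t, (joinProb θ p Δ (X n) s i - joinProb θ p Δ q s i) := by
      rw [ha, ← intervalIntegral.integral_sub (hJX.const_mul lam) (hJq.const_mul lam),
        ← intervalIntegral.integral_const_mul]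
      simp only [mul_sub]
    have e2 : d - ∫ s in (0 : ℝ)..t, μ * q s i
        = μ * ∫ s in (0 : ℝ)..t, (X n s i - q s i) := by
      rw [hd, ← intervalIntegral.integral_sub ((hXI t ht).const_mul μ) ((hqI t ht).const_mul μ),
        ← intervalIntegral.integral_const_mul]
      simp only [mul_sub]
    have e3 : q t i = φ 0 i + ((∫ s in (0 : ℝ)..t, lam * joinProb θ p Δ q s i)
        - ∫ s in (0 : ℝ)..t, μ * q s i) := by
      rw [hsol.eqn t ht.1 i,
        ← intervalIntegral.integral_sub (hJq.const_mul lam) ((hqI t ht).const_mul μ)]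
      rfl
    have b1 : |lam * ∫ s in (0 : ℝ)..t, (joinProb θ p Δ (X n) s i - joinProb θ p Δ q s i)| ≤ κ := by
      rw [abs_mul, abs_of_nonneg hlam]
      refine le_trans ?_ ((le_abs_self _).trans hjκ.le)
      gcongr
      refine (intervalIntegral.abs_integral_le_integral_abs ht.1).trans ?_
      refine intervalIntegral.integral_mono_interval le_rfl ht.1 ht.2
        (Eventually.of_forall fun s => abs_nonneg _) ?_
      exact ((intervalIntegrable_joinProb_of_comp_max hn.measurable i hT).sub
        (intervalIntegrable_joinProb_of_comp_max hq i hT)).abs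
    have b2 : |μ * ∫ s in (0 : ℝ)..t, (X n s i - q s i)|
        ≤ μ * ∫ s in (0 : ℝ)..t, |X n s i - q s i| := by
      rw [abs_mul, abs_of_nonneg hμ]
      gcongr
      exact intervalIntegral.abs_integral_le_integral_abs ht.1
    have b3 := abs_le.1 (haκ a haM)
    have b4 := abs_le.1 (hdκ d hdM)
    have b5 := abs_lt.1 h0κ
    have b1' := abs_le.1 b1
    have b2' := abs_le.1 b2
    have e4 := hn.eqn t ht.1 i
    rw [← ha, ← hd] at e4
    rw [abs_le]
    constructor <;> linarith
  intro t ht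
  have hdint : IntegrableOn (fun s => |X n s i - q s i|) (Icc 0 T) :=
    (hXint.sub ((intervalIntegrable_iff_integrableOn_Icc_of_le hT).1 (hqI T ⟨hT, le_rfl⟩))).abs
  calc |X n t i - q t i| ≤ 4 * κ * Real.exp (μ * t) := gronwall_integral hμ hdint hbound t ht
    _ ≤ 4 * κ * C := by rw [hC]; gcongr; exact ht.2
    _ = ε / 2 := by rw [hκ]; field_simp; norm_num
    _ < ε := by linarith

/-- The method of steps for the convergence: at times up to `(n + 1) δ` the choice probabilities are
functions of the history and of the path up to `n δ`. -/
theorem tendstoUniformlyOn_of_history (hlam : 0 ≤ lam) (hμ : 0 ≤ μ) (hΔ : ∀ k, 0 < Δ k)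
    (hsol : IsFluidSolution lam μ θ p Δ φ q) (hq : Measurable fun r => q (max r (-maxDelay Δ)))
    (hya : ∀ i, HasUnitRate (ya i)) (hyd : ∀ i, HasUnitRate (yd i))
    (hX : ∀ᶠ n in atTop, IsScaledPath lam μ θ p Δ ya yd n (X n))
    (h0 : ∀ i, Tendsto (fun n => X n 0 i) atTop (𝓝 (φ 0 i)))
    (hhist : ∀ᵐ s, s ∈ Icc (-maxDelay Δ) 0 → ∀ i, Tendsto (fun n => X n s i) atTop (𝓝 (φ s i)))
    (T : ℝ) : TendstoUniformlyOn X q atTop (Icc 0 T) := by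
  obtain ⟨δ, hδ0, hδ⟩ := exists_pos_le_delay hΔ
  have hD := maxDelay_nonneg hΔ
  -- the times whose shifts by a delay hit the exceptional null set of the history form a null set
  have hshift : ∀ᵐ s, ∀ k, s - Δ k ∈ Icc (-maxDelay Δ) 0 →
      ∀ i, Tendsto (fun n => X n (s - Δ k) i) atTop (𝓝 (φ (s - Δ k) i)) :=
    ae_all_iff.2 fun k =>
      (measurePreserving_sub_right volume (Δ k)).quasiMeasurePreserving.ae hhist
  have hunif : ∀ n : ℕ, TendstoUniformlyOn X q atTop (Icc 0 (n * δ)) := by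
    intro n
    induction n with
    | zero =>
      refine tendstoUniformlyOn_of_joinProb hlam hμ hD hsol hq hya hyd hX h0 (by simp) ?_
      have : ∀ᵐ s : ℝ, s ≠ 0 := by simp [ae_iff]
      filter_upwards [this] with s hs hs'
      exact absurd (by simpa using hs') hs
    | succ n ih =>
      refine tendstoUniformlyOn_of_joinProb hlam hμ hD hsol hq hya hyd hX h0 (by positivity) ?_
      filter_upwards [hshift] with s hs hsT i
      refine tendsto_joinProb (fun k => tendsto_pi_nhds.2 fun j => ?_) i
      have hk : -maxDelay Δ ≤ s - Δ k := by linarith [le_maxDelay Δ k, hsT.1]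
      obtain hle | hge := le_total (s - Δ k) 0
      · rw [hsol.history _ ⟨hk, hle⟩]
        exact hs k ⟨hk, hle⟩ j
      · refine tendsto_pi_nhds.1 (ih.tendsto_at ⟨hge, ?_⟩) j
        have := hsT.2
        push_cast at this
        linarith [hδ k]
  refine (hunif ⌈T / δ⌉₊).mono (Icc_subset_Icc_right ?_)
  have := Nat.le_ceil (T / δ)
  rwa [div_le_iff₀ hδ0] at this

end Path

end MultiDelayQueue

open MultiDelayQueue in
theorem theorem1 {Ω : Type*} [MeasurableSpace Ω] (P : Measure Ω) [IsProbabilityMeasure P]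
    (N m : ℕ) (lam μ θ : ℝ) (hlam : 0 ≤ lam) (hμ : 0 ≤ μ)
    (p Δ : Fin m → ℝ) (hp : ∀ k, 0 ≤ p k) (hp1 : ∑ k, p k = 1) (hΔ : ∀ k, 0 < Δ k)
    (Ya Yd : Fin N → ℝ≥0 → Ω → ℕ)
    (hYa : ∀ i, MultiDelayQueue.IsUnitPoissonProcess (Ya i) P)
    (hYd : ∀ i, MultiDelayQueue.IsUnitPoissonProcess (Yd i) P)
    (Q : ℕ → ℝ → Ω → Fin N → ℝ)
    (hQ : ∀ η : ℕ, 1 ≤ η → MultiDelayQueue.IsScaledQueue P lam μ θ p Δ Ya Yd η (Q η))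
    (φ : ℝ → Fin N → ℝ)
    (hφ : ∀ s ∈ Icc (-MultiDelayQueue.maxDelay Δ) 0, ∀ i,
      ∀ᵐ ω ∂P, Tendsto (fun η => Q η s ω i) atTop (𝓝 (φ s i))) :
    ∃ q : ℝ → Fin N → ℝ,
      MultiDelayQueue.IsFluidSolution lam μ θ p Δ φ q ∧
      (∀ q' : ℝ → Fin N → ℝ, MultiDelayQueue.IsFluidSolution lam μ θ p Δ φ q' →
        ∀ t, -MultiDelayQueue.maxDelay Δ ≤ t → q' t = q t) ∧
      (ContinuousOn φ (Icc (-MultiDelayQueue.maxDelay Δ) 0) → ∀ t, 0 ≤ t → ∀ i,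
        HasDerivWithinAt (fun s => q s i)
          (lam * MultiDelayQueue.mnl θ (MultiDelayQueue.delayedInfo p Δ q t) i - μ * q t i)
          (Ici 0) t) ∧
      ∀ᵐ ω ∂P, ∀ K : Set ℝ, IsCompact K → K ⊆ Ici 0 →
        TendstoUniformlyOn (fun η t => Q η t ω) q atTop K := by
  have hD : 0 ≤ maxDelay Δ := maxDelay_nonneg hΔ
  -- the projection of the time axis to the history interval
  set π : ℝ → ℝ := fun s => max (-maxDelay Δ) (min s 0) with hπ
  have hπm : Measurable π := by fun_prop
  have hπI : ∀ s, π s ∈ Icc (-maxDelay Δ) 0 := fun s =>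
    ⟨le_max_left _ _, max_le (by linarith) (min_le_right _ _)⟩
  have hπeq : ∀ s ∈ Icc (-maxDelay Δ) 0, π s = s := fun s hs => by
    simp [hπ, min_eq_left hs.2, max_eq_right hs.1]
  set ψ : ℝ → Fin N → ℝ := fun s => φ (π s) with hψ
  -- the histories, shifted to positive indices and extended to the whole line
  have hQm : ∀ n : ℕ, ∀ i, Measurable fun z : ℝ × Ω => Q (n + 1) (π z.1) z.2 i := by
    intro n i
    have h1 : Measurable fun z : ℝ × Ω =>
        ((⟨π z.1, (hπI z.1).1⟩ : Ici (-maxDelay Δ)), z.2) :=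
      ((hπm.comp measurable_fst).subtype_mk).prodMk measurable_snd
    exact (measurable_pi_apply i).comp ((hQ (n + 1) (by omega)).measurable.comp h1)
  have hQφ : ∀ i, ∀ s, ∀ᵐ ω ∂P,
      Tendsto (fun n => Q (n + 1) (π s) ω i) atTop (𝓝 (ψ s i)) := fun i s =>
    (hφ (π s) (hπI s) i).mono fun ω hω =>
      (tendsto_add_atTop_iff_nat (f := fun η => Q η (π s) ω i) 1).2 hω
  have hψi : ∀ i, Measurable fun s => ψ s i := fun i =>
    measurable_of_forall_ae_tendsto (fun n => hQm n i) (hQφ i)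
  have hψm : Measurable ψ := measurable_pi_lambda _ hψi
  obtain ⟨q, hqm, hfix⟩ := exists_measurable_fixedPoint (lam := lam) (μ := μ) (θ := θ) (p := p)
    hΔ hψm
  have hsol : IsFluidSolution lam μ θ p Δ φ q :=
    isFluidSolution_of_fixedPoint hD (fun s hs => by rw [hψ]; simp only [hπeq s hs]) hqm hfix
  refine ⟨q, hsol, fun q' h' => hsol.unique hμ hΔ h',
    fun hc t ht i => hsol.hasDerivWithinAt hD hc ht i, ?_⟩
  have hae : ∀ᵐ ω ∂P, ∀ i, ∀ᵐ s : ℝ,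
      Tendsto (fun n => Q (n + 1) (π s) ω i) atTop (𝓝 (ψ s i)) :=
    ae_all_iff.2 fun i => ae_ae_tendsto (fun n => hQm n i) (hψi i) (hQφ i)
  have h0 : ∀ᵐ ω ∂P, ∀ i, Tendsto (fun η => Q η 0 ω i) atTop (𝓝 (φ 0 i)) :=
    ae_all_iff.2 fun i => hφ 0 ⟨by linarith, le_rfl⟩ i
  have hnn : ∀ᵐ ω ∂P, ∀ n : ℕ, ∀ t, 0 ≤ t → ∀ i, 0 ≤ Q (n + 1) t ω i :=
    ae_all_iff.2 fun n => (hQ (n + 1) (by omega)).nonneg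
  have heq := ae_all_iff.2 fun n : ℕ => (hQ (n + 1) (by omega)).eqn
  filter_upwards [hae, h0, hnn, heq, ae_all_iff.2 fun i => (hYa i).hasUnitRate,
    ae_all_iff.2 fun i => (hYd i).hasUnitRate] with ω hae h0 hnn heq ha hd K hK hK0
  obtain ⟨T, hT⟩ := hK.bddAbove
  refine TendstoUniformlyOn.mono ?_ (show K ⊆ Icc 0 T from fun t ht => ⟨hK0 ht, hT ht⟩)
  refine tendstoUniformlyOn_of_history (X := fun η t => Q η t ω) hlam hμ hΔ hsol
    (hqm.comp (by fun_prop)) ha hd ?_ h0 ?_ T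
  · filter_upwards [eventually_ge_atTop 1] with n hn
    obtain ⟨n, rfl⟩ := Nat.exists_eq_add_of_le' hn
    refine ⟨?_, hnn n, heq n⟩
    have h1 : Measurable fun r : ℝ =>
        ((⟨max r (-maxDelay Δ), mem_Ici.2 (le_max_right r _)⟩ : Ici (-maxDelay Δ)), ω) :=
      (Measurable.subtype_mk (by fun_prop)).prodMk measurable_const
    exact (hQ (n + 1) hn).measurable.comp h1
  · filter_upwards [ae_all_iff.2 hae] with s hs hsI i
    have := hs i
    simp only [hψ, hπeq s hsI] at this
    exact (tendsto_add_atTop_iff_nat (f := fun η => Q η s ω i) 1).1 this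

end
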